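/- For an integer $i\ge 1$ let $R'_i$ be the bigraph (bipartite graph with fixed partite sets) with vertices $x, y', x', y_1'', x_1'', y_2'', x''$, $p_1,\dots,p_{i+1}$, $q_1,\dots,q_{i+1}$ and edges $xy',\ y'x',\ xy_1'',\ y_1''x_1'',\ xy_2'',\ y_1''x'',\ y_2''x''$, $xp_1,\ xq_1$, and $p_kp_{k+1},\ p_kq_{k+1}$ for $1\le k\le i$. One partite set consists of $x,x',x_1'',x''$ and the $p_k,q_k$ with $k$ even, the other of the remaining vertices. (We write $y_n=p_{2n-1}$, $x_n=p_{2n}$, $y_n'=q_{2n-1}$, $x_n'=q_{2n}$, $u=p_i$, $v'=p_{i+1}$, $v''=q_{i+1}$.) Let $R_i$ arise from $R'_i$ by attaching one new pendant vertex to $v'$ and another one to $v''$. Let $\mathcal U$ be the set of all real intervals $[a,a+1]$, $(a,a+1)$, $[a,a+1)$, $(a,a+1]$ with $a\in\mathbb R$. A $\mathcal U$-representation of a bigraph $B$ is a map $I$ from its vertices to $\mathcal U$ such that two distinct vertices $v,w$ are adjacent if and only if they lie in different partite sets and $I(v)\cap I(w)\ne\emptyset$; a bigraph that has one is a mixed unit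 interval bigraph. A trivial modification leads from one $\mathcal U$-representation of $B$ to another $\mathcal U$-representation of $B$ by one of the following: shifting one interval; changing the type (open, closed, half-open) of one interval while keeping its end points; reflecting all intervals about a point; translating all intervals by the same amount; relabeling, that is, reassigning the intervals to the vertices so that each partite set is represented by the same set of intervals as before. Let $i\ge1$. (a) The map $I$ with $I(x)=[0,1]$, $I(y')=I(x')=(0,1)$, $I(y_1'')=[-1,0]$, $I(x_1'')=[-2,-1]$ or $(-2,-1]$, $I(y_2'')=(-1,0]$, $I(x'')=(-1,0)$, $I(p_k)=[k,k+1]$ and $I(q_k)=[k,k+1)$ for $1\le k\le i+1$ (so $I(y_n)=[2n-1,2n]$, $I(x_n)=[2n,2n+1]$, $I(y_n')=[2n-1,2n)$, $I(x_n')=[2n,2n+1)$, $I(u)=[i,i+1]$, $I(v')=[i+1,i+2]$, $I(v'')=[i+1,i+2)$) is, for both choices of $I(x_1'')$, a $\mathcal U$-representation of $R'_i$, and it is unique up to trivial modifications: every $\mathcal U$-representation of $R'_i$ arises from it by a finite sequence of trivial modifications. (b) $R_i$ is a forbidden induced subgraph for the class of mixed unit interval bigraphs: no mixed unit interval bigraph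 contains $R_i$ as an induced subgraph. -/

import Mathlib

universe u

namespace MixedUnitBigraph

/-- A bigraph `B = (X, Y, E)`: a simple graph with a fixed bipartition of its vertex set. -/
structure Bigraph (V : Type u) where
  graph : SimpleGraph V
  X : Set V
  Y : Set V
  cover : X ∪ Y = Set.univ
  bipartite : graph.IsBipartiteWith X Y

/-- `U⁺⁺`, the unit closed intervals. -/
def closedUnit : Set (Set ℝ) := {S | ∃ a : ℝ, S = Set.Icc a (a + 1)}

/-- `U⁻⁻`, the unit open intervals. -/
def openUnit : Set (Set ℝ) := {S | ∃ a : ℝ, S = Set.Ioo a (a + 1)}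

/-- `U⁺⁻`, the unit closed-open intervals. -/
def closedOpenUnit : Set (Set ℝ) := {S | ∃ a : ℝ, S = Set.Ico a (a + 1)}

/-- `U⁻⁺`, the unit open-closed intervals. -/
def openClosedUnit : Set (Set ℝ) := {S | ∃ a : ℝ, S = Set.Ioc a (a + 1)}

/-- `U`, the unit intervals of all four types. -/
def mixedUnit : Set (Set ℝ) := closedUnit ∪ openUnit ∪ closedOpenUnit ∪ openClosedUnit

namespace Bigraph

variable {V : Type u}

/-- `u` and `v` lie in different partite sets. -/
def Opposite (B : Bigraph V) (u v : V) : Prop :=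
  (u ∈ B.X ∧ v ∈ B.Y) ∨ (u ∈ B.Y ∧ v ∈ B.X)

/-- `I` is an `M`-intersection representation of `B`. -/
def IsRep (B : Bigraph V) (M : Set (Set ℝ)) (I : V → Set ℝ) : Prop :=
  (∀ v, I v ∈ M) ∧
    ∀ u v, u ≠ v → (B.graph.Adj u v ↔ (I u ∩ I v).Nonempty ∧ B.Opposite u v)

/-- `B` is a mixed unit interval bigraph (a `U`-bigraph). -/
def IsMixedUnitInterval (B : Bigraph V) : Prop :=
  ∃ I : V → Set ℝ, B.IsRep mixedUnit I

/-- The elementary changes of a family of intervals indexed by the vertices of `B`. -/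
inductive Change (B : Bigraph V) : (V → Set ℝ) → (V → Set ℝ) → Prop
  /-- one interval is shifted, all others stay -/
  | shift {I J : V → Set ℝ} (v : V) (t : ℝ) (hv : J v = (fun s => s + t) '' I v)
      (h : ∀ w, w ≠ v → J w = I w) : Change B I J
  /-- one interval changes its type, its end points and all other intervals stay -/
  | retype {I J : V → Set ℝ} (v : V) (hl : sInf (J v) = sInf (I v))
      (hr : sSup (J v) = sSup (I v)) (h : ∀ w, w ≠ v → J w = I w) : Change B I J
  /-- the entire model is reflected about the point `c` -/
  | reflect {I J : V → Set ℝ} (c : ℝ) (h : ∀ v, J v = (fun s => 2 * c - s) '' I v) : Change B I J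
  /-- the entire model is translated by `t` -/
  | translate {I J : V → Set ℝ} (t : ℝ) (h : ∀ v, J v = (fun s => s + t) '' I v) : Change B I J
  /-- the intervals of the model stay, but they are assigned to other vertices of the same partite
  set (several vertices may share an interval) -/
  | relabel {I J : V → Set ℝ} (hX : J '' B.X = I '' B.X) (hY : J '' B.Y = I '' B.Y) : Change B I J

/-- A trivial modification: an elementary change that leads from one `U`-representation of `B` to
another one, so that it preserves the intersections and the non-intersections between intervals of
different partite sets. -/
def TrivialModification (B : Bigraph V) (I J : V → Set ℝ) : Prop :=
  B.IsRep mixedUnit I ∧ B.IsRep mixedUnit J ∧ B.Change I J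

/-- `I` is a `U`-representation of `B` and it is unique up to trivial modifications: each
`U`-representation of `B` arises from `I` by a finite sequence of trivial modifications. -/
def IsUniqueRep (B : Bigraph V) (I : V → Set ℝ) : Prop :=
  B.IsRep mixedUnit I ∧
    ∀ J : V → Set ℝ, B.IsRep mixedUnit J → Relation.ReflTransGen B.TrivialModification I J

end Bigraph

open scoped SimpleGraph in
/-- `H` is a forbidden induced subgraph for the class of mixed unit interval bigraphs: no bigraph of
the class contains `H` as an induced subgraph. -/
def IsForbiddenInducedSubgraph {W : Type} (H : Bigraph W) : Prop :=
  ∀ (V : Type u) (B : Bigraph V), B.IsMixedUnitInterval → ¬ H.graph ⊴ B.graph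

/-- The vertices of `R'_i`. The path `y₁, x₁, y₂, x₂, …, u, v'` is `p 0, p 1, …, p i`, so that
`yₙ = p (2n-2)`, `xₙ = p (2n-1)`, `v' = p i` and, for `i ≥ 1`, `u = p (i-1)`. The pendant vertices
`y₁', x₁', y₂', x₂', …, v''` are `q 0, q 1, …, q i`, so that `yₙ' = q (2n-2)`, `xₙ' = q (2n-1)` and
`v'' = q i`. -/
inductive RPVert (i : ℕ) : Type
  | x
  | y'
  | x'
  | y₁''
  | x₁''
  | y₂''
  | x''
  | p (k : Fin (i + 1))
  | q (k : Fin (i + 1))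

/-- The vertices of `R'_i` in the partite set `X`. -/
def RPVert.InX {i : ℕ} : RPVert i → Prop
  | .x => True
  | .y' => False
  | .x' => True
  | .y₁'' => False
  | .x₁'' => True
  | .y₂'' => False
  | .x'' => True
  | .p k => Odd (k : ℕ)
  | .q k => Odd (k : ℕ)

/-- The edges of `R'_i`. -/
inductive RPEdge (i : ℕ) : RPVert i → RPVert i → Prop
  | x_y' : RPEdge i .x .y'
  | y'_x' : RPEdge i .y' .x'
  | x_y₁'' : RPEdge i .x .y₁''
  | y₁''_x₁'' : RPEdge i .y₁'' .x₁''
  | x_y₂'' : RPEdge i .x .y₂''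
  | y₁''_x'' : RPEdge i .y₁'' .x''
  | y₂''_x'' : RPEdge i .y₂'' .x''
  | x_p : RPEdge i .x (.p 0)
  | x_q : RPEdge i .x (.q 0)
  | p_p (k : Fin i) : RPEdge i (.p k.castSucc) (.p k.succ)
  | p_q (k : Fin i) : RPEdge i (.p k.castSucc) (.q k.succ)

theorem RPEdge.inX_iff {i : ℕ} {a b : RPVert i} (h : RPEdge i a b) : a.InX ↔ ¬ b.InX := by
  cases h <;> simp [RPVert.InX, Nat.odd_add_one]

/-- The bigraph `R'_i` (for `i ≥ 1`). -/
def RP (i : ℕ) : Bigraph (RPVert i) where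
  graph := SimpleGraph.fromRel (RPEdge i)
  X := {v | v.InX}
  Y := {v | ¬ v.InX}
  cover := by ext v; simp [Classical.em]
  bipartite :=
    { disjoint := Set.disjoint_left.2 fun _ h h' => h' h
      mem_of_adj := by
        intro a b h
        rw [SimpleGraph.fromRel_adj] at h
        simp only [Set.mem_ofPred_eq]
        rcases h.2 with h | h <;> have := h.inX_iff <;> tauto }

/-- The vertices of `R_i`: those of `R'_i` and two more. -/
inductive RVert (i : ℕ) : Type
  | core (v : RPVert i)
  | w'
  | w''

/-- The vertices of `R_i` in the partite set `X`. -/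
def RVert.InX {i : ℕ} : RVert i → Prop
  | .core v => v.InX
  | .w' => ¬ Odd i
  | .w'' => ¬ Odd i

/-- The edges of `R_i`: those of `R'_i`, and a pendant edge at each of `v'` and `v''`. -/
inductive REdge (i : ℕ) : RVert i → RVert i → Prop
  | core {a b : RPVert i} (h : RPEdge i a b) : REdge i (.core a) (.core b)
  | v'_w' : REdge i (.core (.p (Fin.last i))) .w'
  | v''_w'' : REdge i (.core (.q (Fin.last i))) .w''

theorem REdge.inX_iff {i : ℕ} {a b : RVert i} (h : REdge i a b) : a.InX ↔ ¬ b.InX := by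
  cases h with
  | core h => exact h.inX_iff
  | v'_w' => simp [RVert.InX, RPVert.InX]
  | v''_w'' => simp [RVert.InX, RPVert.InX]

/-- The bigraph `R_i` (for `i ≥ 1`). -/
def R (i : ℕ) : Bigraph (RVert i) where
  graph := SimpleGraph.fromRel (REdge i)
  X := {v | v.InX}
  Y := {v | ¬ v.InX}
  cover := by ext v; simp [Classical.em]
  bipartite :=
    { disjoint := Set.disjoint_left.2 fun _ h h' => h' h
      mem_of_adj := by
        intro a b h
        rw [SimpleGraph.fromRel_adj] at h
        simp only [Set.mem_ofPred_eq]
        rcases h.2 with h | h <;> have := h.inX_iff <;> tauto }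

/-- The specified intervals, with `A` for `x₁''`. So `yₙ ↦ [2n-1, 2n]`, `xₙ ↦ [2n, 2n+1]`,
`yₙ' ↦ [2n-1, 2n)`, `xₙ' ↦ [2n, 2n+1)`, `u ↦ [i, i+1]`, `v' ↦ [i+1, i+2]`, `v'' ↦ [i+1, i+2)`. -/
def model (i : ℕ) (A : Set ℝ) : RPVert i → Set ℝ
  | .x => Set.Icc 0 1
  | .y' => Set.Ioo 0 1
  | .x' => Set.Ioo 0 1
  | .y₁'' => Set.Icc (-1) 0
  | .x₁'' => A
  | .y₂'' => Set.Ioc (-1) 0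
  | .x'' => Set.Ioo (-1) 0
  | .p k => Set.Icc (((k : ℕ) : ℝ) + 1) (((k : ℕ) : ℝ) + 2)
  | .q k => Set.Ico (((k : ℕ) : ℝ) + 1) (((k : ℕ) : ℝ) + 2)

end MixedUnitBigraph

/-! Unit length makes everything rigid. The vertex `x` is the center of a subdivided claw with legs
`y', x'`, `y₁'', x₁''` and `p 0, p 1`. The inner intervals of these legs are linearly ordered, and
the outer interval of the middle leg is disjoint from the inner intervals on both sides. Those two
meet `x`, so all lengths must match exactly: `x` is closed, the squeezed interval is its interior,
and the two inner intervals touch `x` at its end points (`claw`).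

The leg of `y₁''` cannot be the middle one, since `x''` would then coincide with `x₁''`. If the leg
of `y'` is in the middle, then up to translation and reflection all end points other than those of
`y'` and `x''` are forced, one vertex after the other along the path, and so are most types
(`Represents.chain`, `Represents.eq_normalForm`). If the leg of `p 0` is in the middle, then `p 1`
and `q 1` get the same interval, which forces `i = 1`, and a relabeling exchanges this leg with that
of `y'`. The remaining freedom in the normal form is removed by retyping and shifting, which proves
uniqueness.

For `R i`, the intervals of `v'` and `v''` share both end points and differ in at most one of the
two types. So one contains the other, and they cannot both have private neighbors. -/

namespace MixedUnitBigraph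

/-! ### Unit intervals given by end points and types -/

/-- A unit interval of one of the four types: `a` is the left end point, `l` and `r` tell whether
the left and the right end point belong to it. -/
@[ext] structure UnitIvl where
  a : ℝ
  l : Prop
  r : Prop

namespace UnitIvl

def toSet (s : UnitIvl) : Set ℝ :=
  {t | (s.a < t ∨ s.l ∧ t = s.a) ∧ (t < s.a + 1 ∨ s.r ∧ t = s.a + 1)}

/-- `s` lies to the left of `t` and is disjoint from it. -/
def Before (s t : UnitIvl) : Prop :=
  s.a + 1 < t.a ∨ s.a + 1 = t.a ∧ ¬ (s.r ∧ t.l)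

def Meet (s t : UnitIvl) : Prop := ¬ s.Before t ∧ ¬ t.Before s

theorem Meet.symm {s t : UnitIvl} (h : s.Meet t) : t.Meet s := ⟨h.2, h.1⟩

theorem meet_comm {s t : UnitIvl} : s.Meet t ↔ t.Meet s := ⟨Meet.symm, Meet.symm⟩

/-- This replaces intersections by linear conditions on end points and types. The common point is
the shared end point if the intervals touch, and the midpoint of the overlap otherwise. -/
theorem inter_nonempty_iff (s t : UnitIvl) : (s.toSet ∩ t.toSet).Nonempty ↔ s.Meet t := by
  obtain ⟨a, l, r⟩ := s
  obtain ⟨b, l', r'⟩ := t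
  simp only [toSet, Meet, Before]
  constructor
  · rintro ⟨z, ⟨h1, h2⟩, h3, h4⟩
    grind
  · rintro ⟨h1, h2⟩
    rcases lt_trichotomy (a + 1) b with h | h | h
    · grind
    · refine ⟨b, ⟨?_, ?_⟩, ?_, ?_⟩ <;> grind
    · rcases lt_trichotomy (b + 1) a with h' | h' | h'
      · grind
      · refine ⟨a, ⟨?_, ?_⟩, ?_, ?_⟩ <;> grind
      · rcases le_total a b with h3 | h3
        · refine ⟨(b + (a + 1)) / 2, ⟨Or.inl ?_, Or.inl ?_⟩, Or.inl ?_, Or.inl ?_⟩ <;> linarith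
        · refine ⟨(a + (b + 1)) / 2, ⟨Or.inl ?_, Or.inl ?_⟩, Or.inl ?_, Or.inl ?_⟩ <;> linarith

theorem toSet_closed (a : ℝ) : toSet ⟨a, True, True⟩ = Set.Icc a (a + 1) := by
  ext t; simp only [toSet, Set.mem_ofPred_eq, Set.mem_Icc, le_iff_lt_or_eq]; grind

theorem toSet_open (a : ℝ) : toSet ⟨a, False, False⟩ = Set.Ioo a (a + 1) := by
  ext t; simp only [toSet, Set.mem_ofPred_eq, Set.mem_Ioo]; grind

theorem toSet_closedOpen (a : ℝ) : toSet ⟨a, True, False⟩ = Set.Ico a (a + 1) := by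
  ext t; simp only [toSet, Set.mem_ofPred_eq, Set.mem_Ico, le_iff_lt_or_eq]; grind

theorem toSet_openClosed (a : ℝ) : toSet ⟨a, False, True⟩ = Set.Ioc a (a + 1) := by
  ext t; simp only [toSet, Set.mem_ofPred_eq, Set.mem_Ioc, le_iff_lt_or_eq]; grind

theorem toSet_mem_mixedUnit (s : UnitIvl) : s.toSet ∈ mixedUnit := by
  obtain ⟨a, l, r⟩ := s
  by_cases hl : l <;> by_cases hr : r <;> simp only [hl, hr, mixedUnit, Set.mem_union]
  · exact Or.inl (Or.inl (Or.inl ⟨a, toSet_closed a⟩))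
  · exact Or.inl (Or.inr ⟨a, toSet_closedOpen a⟩)
  · exact Or.inr ⟨a, toSet_openClosed a⟩
  · exact Or.inl (Or.inl (Or.inr ⟨a, toSet_open a⟩))

theorem exists_toSet_eq {S : Set ℝ} (h : S ∈ mixedUnit) : ∃ s : UnitIvl, s.toSet = S := by
  rcases h with ((⟨a, rfl⟩ | ⟨a, rfl⟩) | ⟨a, rfl⟩) | ⟨a, rfl⟩
  · exact ⟨_, toSet_closed a⟩
  · exact ⟨_, toSet_open a⟩
  · exact ⟨_, toSet_closedOpen a⟩
  · exact ⟨_, toSet_openClosed a⟩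

theorem sInf_toSet (s : UnitIvl) : sInf s.toSet = s.a := by
  obtain ⟨a, l, r⟩ := s
  have h : a < a + 1 := by linarith
  by_cases hl : l <;> by_cases hr : r <;> simp only [hl, hr]
  · rw [toSet_closed, csInf_Icc h.le]
  · rw [toSet_closedOpen, csInf_Ico h]
  · rw [toSet_openClosed, csInf_Ioc h]
  · rw [toSet_open, csInf_Ioo h]

theorem sSup_toSet (s : UnitIvl) : sSup s.toSet = s.a + 1 := by
  obtain ⟨a, l, r⟩ := s
  have h : a < a + 1 := by linarith
  by_cases hl : l <;> by_cases hr : r <;> simp only [hl, hr]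
  · rw [toSet_closed, csSup_Icc h.le]
  · rw [toSet_closedOpen, csSup_Ico h]
  · rw [toSet_openClosed, csSup_Ioc h]
  · rw [toSet_open, csSup_Ioo h]

def translate (t : ℝ) (s : UnitIvl) : UnitIvl := ⟨s.a + t, s.l, s.r⟩

/-- The reflection of `s` about `c`. -/
def reflect (c : ℝ) (s : UnitIvl) : UnitIvl := ⟨2 * c - s.a - 1, s.r, s.l⟩

theorem toSet_translate (t : ℝ) (s : UnitIvl) :
    (s.translate t).toSet = (fun z => z + t) '' s.toSet := by
  ext z
  simp only [Set.mem_image, toSet, translate, Set.mem_ofPred_eq]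
  constructor
  · intro h
    exact ⟨z - t, by grind, by ring⟩
  · rintro ⟨w, h, rfl⟩
    grind

theorem toSet_reflect (c : ℝ) (s : UnitIvl) :
    (s.reflect c).toSet = (fun z => 2 * c - z) '' s.toSet := by
  ext z
  simp only [Set.mem_image, toSet, reflect, Set.mem_ofPred_eq]
  constructor
  · intro h
    exact ⟨2 * c - z, by grind, by ring⟩
  · rintro ⟨w, h, rfl⟩
    grind

theorem meet_translate (t : ℝ) (s s' : UnitIvl) :
    (s.translate t).Meet (s'.translate t) ↔ s.Meet s' := by
  simp only [Meet, Before, translate]; grind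

theorem meet_reflect (c : ℝ) (s s' : UnitIvl) :
    (s.reflect c).Meet (s'.reflect c) ↔ s.Meet s' := by
  simp only [Meet, Before, reflect]; grind

/-! ### Squeezed intervals and subdivided claws -/

/-- `m` fits exactly between `s` and `t`, as `x` meets both of `s` and `t`. -/
structure Squeezed (x s m t : UnitIvl) : Prop where
  x_l : x.l
  x_r : x.r
  s_a : s.a = x.a - 1
  s_r : s.r
  t_a : t.a = x.a + 1
  t_l : t.l
  m_a : m.a = x.a
  m_l : ¬ m.l
  m_r : ¬ m.r

/-- The gap between `s` and `t` has length at least 1 because of `m` and at most 1 because of `x`,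
so every inequality is tight. -/
theorem squeezed_of_before {x s m t : UnitIvl} (hs : x.Meet s) (ht : x.Meet t)
    (h : s.Before m) (h' : m.Before t) : Squeezed x s m t := by
  simp only [Meet, Before] at *
  constructor <;> grind

theorem Squeezed.reflect {x s m t : UnitIvl} (h : Squeezed x s m t) (c : ℝ) :
    Squeezed (x.reflect c) (t.reflect c) (m.reflect c) (s.reflect c) := by
  obtain ⟨h1, h2, h3, h4, h5, h6, h7, h8, h9⟩ := h
  constructor <;> simp only [UnitIvl.reflect] <;> first | assumption | linarith

theorem Squeezed.translate {x s m t : UnitIvl} (h : Squeezed x s m t) (c : ℝ) :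
    Squeezed (x.translate c) (s.translate c) (m.translate c) (t.translate c) := by
  obtain ⟨h1, h2, h3, h4, h5, h6, h7, h8, h9⟩ := h
  constructor <;> simp only [UnitIvl.translate] <;> first | assumption | linarith

/-- With a private neighbor each, neither of `s` and `t` contains the other, so one lies further
left and its private neighbor sticks out on that side. -/
theorem order_of_private {s s' t t' : UnitIvl} (hs : s.Meet s') (ht : t.Meet t')
    (hst : ¬ s'.Meet t) (hts : ¬ t'.Meet s) :
    s'.Before t ∧ s.Before t' ∨ t'.Before s ∧ t.Before s' := by
  simp only [Meet, Before] at *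
  grind

/-- In a subdivided claw with center `x` one of the legs is squeezed between the other two. -/
theorem claw {x s s' t t' z z' : UnitIvl} (xs : x.Meet s) (xt : x.Meet t) (xz : x.Meet z)
    (hs : s.Meet s') (ht : t.Meet t') (hz : z.Meet z')
    (h1 : ¬ s'.Meet t) (h2 : ¬ s'.Meet z) (h3 : ¬ t'.Meet s) (h4 : ¬ t'.Meet z)
    (h5 : ¬ z'.Meet s) (h6 : ¬ z'.Meet t) :
    (Squeezed x t s' z ∨ Squeezed x z s' t) ∨ (Squeezed x s t' z ∨ Squeezed x z t' s) ∨
      (Squeezed x s z' t ∨ Squeezed x t z' s) := by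
  -- Each pair of legs is ordered. Six of the eight combinations are linear orders, in which the
  -- outer interval of the middle leg is squeezed; the two cyclic ones are impossible.
  rcases order_of_private hs ht h1 h3 with ⟨a1, a2⟩ | ⟨a1, a2⟩ <;>
  rcases order_of_private hs hz h2 h5 with ⟨b1, b2⟩ | ⟨b1, b2⟩ <;>
  rcases order_of_private ht hz h4 h6 with ⟨c1, c2⟩ | ⟨c1, c2⟩
  · exact Or.inr (Or.inl (Or.inl (squeezed_of_before xs xz a2 c1)))
  · exact Or.inr (Or.inr (Or.inl (squeezed_of_before xs xt b2 c1)))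
  · exfalso; simp only [Meet, Before] at *; grind
  · exact Or.inl (Or.inr (squeezed_of_before xz xt b2 a1))
  · exact Or.inl (Or.inl (squeezed_of_before xt xz a2 b1))
  · exfalso; simp only [Meet, Before] at *; grind
  · exact Or.inr (Or.inr (Or.inr (squeezed_of_before xt xs c2 b1)))
  · exact Or.inr (Or.inl (Or.inr (squeezed_of_before xz xs c2 a1)))

end UnitIvl

open UnitIvl

/-! ### Representations of `R'_i` and the claw at `x` -/

/-- The edges of `R'_i`, as a predicate that unfolds on constructors. -/
def RPVert.Edge {i : ℕ} : RPVert i → RPVert i → Prop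
  | .x, .y' => True
  | .y', .x' => True
  | .x, .y₁'' => True
  | .y₁'', .x₁'' => True
  | .x, .y₂'' => True
  | .y₁'', .x'' => True
  | .y₂'', .x'' => True
  | .x, .p k => (k : ℕ) = 0
  | .x, .q k => (k : ℕ) = 0
  | .p k, .p j => (j : ℕ) = k + 1
  | .p k, .q j => (j : ℕ) = k + 1
  | _, _ => False

theorem rpEdge_iff {i : ℕ} (a b : RPVert i) : RPEdge i a b ↔ a.Edge b := by
  constructor
  · intro h
    cases h <;> simp [RPVert.Edge]
  · intro h
    cases a <;> cases b <;> simp only [RPVert.Edge] at h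
    case x.p k => obtain rfl : k = 0 := Fin.ext h; exact .x_p
    case x.q k => obtain rfl : k = 0 := Fin.ext h; exact .x_q
    case p.p k j =>
      have hk : (k : ℕ) < i := by omega
      obtain rfl : j = (⟨k, hk⟩ : Fin i).succ := Fin.ext h
      exact .p_p ⟨k, hk⟩
    case p.q k j =>
      have hk : (k : ℕ) < i := by omega
      obtain rfl : j = (⟨k, hk⟩ : Fin i).succ := Fin.ext h
      exact .p_q ⟨k, hk⟩
    all_goals constructor

theorem RPVert.Edge.inX_iff {i : ℕ} {a b : RPVert i} (h : a.Edge b) : a.InX ↔ ¬ b.InX :=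
  ((rpEdge_iff a b).2 h).inX_iff

variable {i : ℕ}

/-- The intervals `d` represent `R'_i`. -/
def Represents (d : RPVert i → UnitIvl) : Prop :=
  ∀ u v : RPVert i, u.InX → ¬ v.InX → ((u.Edge v ∨ v.Edge u) ↔ (d u).Meet (d v))

theorem isRep_iff_represents (d : RPVert i → UnitIvl) :
    (RP i).IsRep mixedUnit (fun v => (d v).toSet) ↔ Represents d := by
  have hadj : ∀ u v : RPVert i, (RP i).graph.Adj u v ↔ u ≠ v ∧ (u.Edge v ∨ v.Edge u) := by
    intro u v
    rw [← rpEdge_iff, ← rpEdge_iff]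
    exact SimpleGraph.fromRel_adj _ _ _
  have hopp : ∀ u v : RPVert i,
      (RP i).Opposite u v ↔ (u.InX ∧ ¬ v.InX ∨ ¬ u.InX ∧ v.InX) := fun u v => Iff.rfl
  simp only [Bigraph.IsRep, hadj, hopp, inter_nonempty_iff]
  constructor
  · rintro ⟨-, h⟩ u v hu hv
    have huv : u ≠ v := by rintro rfl; exact hv hu
    have := h u v huv
    tauto
  · refine fun h => ⟨fun v => toSet_mem_mixedUnit _, fun u v huv => ?_⟩
    by_cases hu : u.InX <;> by_cases hv : v.InX
    · have h1 := fun e : u.Edge v => e.inX_iff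
      have h2 := fun e : v.Edge u => e.inX_iff
      tauto
    · have := h u v hu hv
      tauto
    · have := h v u hv hu
      rw [meet_comm] at this
      tauto
    · have h1 := fun e : u.Edge v => e.inX_iff
      have h2 := fun e : v.Edge u => e.inX_iff
      tauto

theorem exists_represents {J : RPVert i → Set ℝ} (h : (RP i).IsRep mixedUnit J) :
    ∃ d : RPVert i → UnitIvl, Represents d ∧ J = fun v => (d v).toSet := by
  choose d hd using fun v => exists_toSet_eq (h.1 v)
  obtain rfl : J = fun v => (d v).toSet := funext fun v => (hd v).symm
  exact ⟨d, (isRep_iff_represents d).1 h, rfl⟩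

theorem Represents.translate {d : RPVert i → UnitIvl} (h : Represents d) (t : ℝ) :
    Represents fun v => (d v).translate t := fun u v hu hv => by
  rw [meet_translate]; exact h u v hu hv

theorem Represents.reflect {d : RPVert i → UnitIvl} (h : Represents d) (c : ℝ) :
    Represents fun v => (d v).reflect c := fun u v hu hv => by
  rw [meet_reflect]; exact h u v hu hv

theorem Represents.meet {d : RPVert i → UnitIvl} (h : Represents d) {u v : RPVert i}
    (e : u.Edge v) : (d u).Meet (d v) := by
  by_cases hu : u.InX
  · exact (h u v hu (e.inX_iff.1 hu)).1 (Or.inl e)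
  · have hv : v.InX := by have := e.inX_iff; tauto
    exact ((h v u hv hu).1 (Or.inr e)).symm

theorem Represents.not_meet {d : RPVert i → UnitIvl} (h : Represents d) {u v : RPVert i}
    (hu : u.InX ↔ ¬ v.InX) (e : ¬ u.Edge v) (e' : ¬ v.Edge u) : ¬ (d u).Meet (d v) := by
  by_cases hx : u.InX
  · have := h u v hx (hu.1 hx)
    tauto
  · have := h v u (by tauto) hx
    rw [meet_comm] at this
    tauto

theorem Represents.exists_squeezed {d : RPVert i → UnitIvl} (h : Represents d) (hi : 1 ≤ i) :
    (Squeezed (d .x) (d .y₁'') (d .x') (d (.p 0)) ∨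
      Squeezed (d .x) (d (.p 0)) (d .x') (d .y₁'')) ∨
    (i = 1 ∧ d (.p (Fin.last i)) = d (.q (Fin.last i)) ∧
      (Squeezed (d .x) (d .y₁'') (d (.p (Fin.last i))) (d .y') ∨
        Squeezed (d .x) (d .y') (d (.p (Fin.last i))) (d .y₁''))) := by
  obtain ⟨k, hk⟩ : ∃ k : Fin (i + 1), (k : ℕ) = 1 := ⟨⟨1, by omega⟩, rfl⟩
  have x_y' := h.meet (u := .x) (v := .y') (by simp [RPVert.Edge])
  have x_y1 := h.meet (u := .x) (v := .y₁'') (by simp [RPVert.Edge])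
  have x_p := h.meet (u := .x) (v := .p 0) (by simp [RPVert.Edge])
  have y'_x' := h.meet (u := .y') (v := .x') (by simp [RPVert.Edge])
  have y1_x1 := h.meet (u := .y₁'') (v := .x₁'') (by simp [RPVert.Edge])
  have y1_x'' := h.meet (u := .y₁'') (v := .x'') (by simp [RPVert.Edge])
  have y2_x'' := h.meet (u := .y₂'') (v := .x'') (by simp [RPVert.Edge])
  have p_p := h.meet (u := .p 0) (v := .p k) (by simp [RPVert.Edge, hk])
  have p_q := h.meet (u := .p 0) (v := .q k) (by simp [RPVert.Edge, hk])
  have x'_y1 := h.not_meet (u := .x') (v := .y₁'') (by simp [RPVert.InX]) (by simp [RPVert.Edge])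
    (by simp [RPVert.Edge])
  have x'_p := h.not_meet (u := .x') (v := .p 0) (by simp [RPVert.InX]) (by simp [RPVert.Edge])
    (by simp [RPVert.Edge])
  have x1_y' := h.not_meet (u := .x₁'') (v := .y') (by simp [RPVert.InX]) (by simp [RPVert.Edge])
    (by simp [RPVert.Edge])
  have x1_p := h.not_meet (u := .x₁'') (v := .p 0) (by simp [RPVert.InX]) (by simp [RPVert.Edge])
    (by simp [RPVert.Edge])
  have x1_y2 := h.not_meet (u := .x₁'') (v := .y₂'') (by simp [RPVert.InX])
    (by simp [RPVert.Edge]) (by simp [RPVert.Edge])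
  have x''_y' := h.not_meet (u := .x'') (v := .y') (by simp [RPVert.InX]) (by simp [RPVert.Edge])
    (by simp [RPVert.Edge])
  have x''_p := h.not_meet (u := .x'') (v := .p 0) (by simp [RPVert.InX]) (by simp [RPVert.Edge])
    (by simp [RPVert.Edge])
  have p_y' := h.not_meet (u := .p k) (v := .y') (by simp [RPVert.InX, hk])
    (by simp [RPVert.Edge]) (by simp [RPVert.Edge])
  have p_y1 := h.not_meet (u := .p k) (v := .y₁'') (by simp [RPVert.InX, hk])
    (by simp [RPVert.Edge]) (by simp [RPVert.Edge])
  have q_y' := h.not_meet (u := .q k) (v := .y') (by simp [RPVert.InX, hk])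
    (by simp [RPVert.Edge]) (by simp [RPVert.Edge])
  have q_y1 := h.not_meet (u := .q k) (v := .y₁'') (by simp [RPVert.InX, hk])
    (by simp [RPVert.Edge]) (by simp [RPVert.Edge])
  rcases claw x_y' x_y1 x_p y'_x' y1_x1 p_p x'_y1 x'_p x1_y' x1_p p_y' p_y1 with H | H | H
  · exact Or.inl H
  -- Here `x₁''` is the interior of `x`. As `x''` meets `y₁''` but neither `y'` nor `p 0`, it is
  -- squeezed as well and equals `x₁''`; but only `x''` meets `y₂''`.
  · exfalso
    clear p_p p_q x'_y1 x'_p p_y' p_y1 q_y' q_y1 y'_x'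
    rcases H with H | H <;> obtain ⟨h1, h2, h3, h4, h5, h6, h7, h8, h9⟩ := H <;>
      simp only [Meet, Before] at * <;> grind
  · right
    -- `q k` meets `p 0` and avoids `y'` and `y₁''` just as `p k` does, so it is squeezed into the
    -- same open interval.
    have hpq : d (.p k) = d (.q k) := by
      clear y'_x' y1_x1 x'_y1 x'_p x1_y' x1_p x1_y2 x''_y' x''_p y2_x'' y1_x'' p_y' p_y1
      rcases H with H | H <;> obtain ⟨h1, h2, h3, h4, h5, h6, h7, h8, h9⟩ := H <;>
      · simp only [Meet, Before] at *
        have : (d (.q k)).a = (d (.p k)).a ∧ ¬ (d (.q k)).l ∧ ¬ (d (.q k)).r := by grind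
        ext <;> simp [*]
    obtain rfl : i = 1 := by
      -- For `i ≥ 2` the vertex `p 2` is adjacent to `p 1` but not to `q 1`.
      by_contra hne
      obtain ⟨j, hj⟩ : ∃ j : Fin (i + 1), (j : ℕ) = 2 := ⟨⟨2, by omega⟩, rfl⟩
      have h1 := h.meet (u := .p k) (v := .p j) (by simp [RPVert.Edge, hk, hj])
      have h2 := h.not_meet (u := .q k) (v := .p j) (by simp [RPVert.InX, hk, hj])
        (by simp [RPVert.Edge]) (by simp [RPVert.Edge, hk, hj])
      exact h2 (hpq ▸ h1)
    obtain rfl : k = Fin.last 1 := Fin.ext hk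
    exact ⟨rfl, hpq, H.symm⟩

/-- Exchanges the legs `y', x'` and `p 0, p 1` of `R'_1`. -/
def swapLegs : RPVert i → RPVert i
  | .y' => .p 0
  | .x' => .p (Fin.last i)
  | .p k => if (k : ℕ) = 0 then .y' else .x'
  | .q k => if (k : ℕ) = 0 then .q 0 else .x'
  | v => v

theorem Represents.comp_swapLegs {d : RPVert i → UnitIvl} (h : Represents d) (hi : i = 1) :
    Represents fun v => d (swapLegs v) := by
  subst hi
  have key : ∀ v : RPVert 1, (swapLegs v).InX ↔ v.InX := by
    intro v
    cases v with
    | p k => fin_cases k <;> simp [swapLegs, RPVert.InX]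
    | q k => fin_cases k <;> simp [swapLegs, RPVert.InX]
    | _ => simp [swapLegs, RPVert.InX]
  intro u v hu hv
  rw [← h _ _ ((key u).2 hu) (mt (key v).1 hv)]
  cases u with
  | p k =>
    cases v with
    | p j => fin_cases k <;> fin_cases j <;> simp_all [swapLegs, RPVert.InX, RPVert.Edge]
    | q j => fin_cases k <;> fin_cases j <;> simp_all [swapLegs, RPVert.InX, RPVert.Edge]
    | _ => fin_cases k <;> simp_all [swapLegs, RPVert.InX, RPVert.Edge]
  | q k =>
    cases v with
    | p j => fin_cases k <;> fin_cases j <;> simp_all [swapLegs, RPVert.InX, RPVert.Edge]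
    | q j => fin_cases k <;> fin_cases j <;> simp_all [swapLegs, RPVert.InX, RPVert.Edge]
    | _ => fin_cases k <;> simp_all [swapLegs, RPVert.InX, RPVert.Edge]
  | _ =>
    cases v with
    | p j => fin_cases j <;> simp_all [swapLegs, RPVert.InX, RPVert.Edge]
    | q j => fin_cases j <;> simp_all [swapLegs, RPVert.InX, RPVert.Edge]
    | _ => simp_all [swapLegs, RPVert.InX, RPVert.Edge]

/-! ### The normal form -/

/-- The representation of `R'_i` up to position and reflection: the intervals of `y'` and `x''` can
be moved a little, and some intervals can be of several types. -/
def normalForm (i : ℕ) (s t : UnitIvl) (l rp rq : Prop) : RPVert i → UnitIvl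
  | .x => ⟨0, True, True⟩
  | .y' => s
  | .x' => ⟨0, False, False⟩
  | .y₁'' => ⟨-1, True, True⟩
  | .x₁'' => ⟨-2, l, True⟩
  | .y₂'' => ⟨-1, False, True⟩
  | .x'' => t
  -- Only at `k = i` are the right ends free, as no later vertex of the path tests them.
  | .p k => ⟨(k : ℕ) + 1, True, (k : ℕ) < i ∨ rp⟩
  | .q k => ⟨(k : ℕ) + 1, True, (k : ℕ) = i ∧ rq⟩

/-- The admissible positions of `y'` and `x''` in the normal form. -/
structure Admissible (s t : UnitIvl) : Prop where
  lt_s : -1 < s.a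
  s_lt : s.a < 1
  lt_t : -2 < t.a
  t_lt : t.a < 0
  before : t.Before s

theorem meet_nat (k j : ℕ) (r r' : Prop) :
    Meet ⟨(k : ℝ) + 1, True, r⟩ ⟨(j : ℝ) + 1, True, r'⟩ ↔
      k ≤ j + 1 ∧ (k = j + 1 → r') ∧ j ≤ k + 1 ∧ (j = k + 1 → r) := by
  have h1 : (k : ℝ) + 1 + 1 < (j : ℝ) + 1 ↔ k + 1 < j := by
    rw [← Nat.cast_lt (α := ℝ)]; push_cast; constructor <;> intro h <;> linarith
  have h2 : (k : ℝ) + 1 + 1 = (j : ℝ) + 1 ↔ j = k + 1 := by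
    rw [← Nat.cast_inj (R := ℝ)]; push_cast; constructor <;> intro h <;> linarith
  have h3 : (j : ℝ) + 1 + 1 < (k : ℝ) + 1 ↔ j + 1 < k := by
    rw [← Nat.cast_lt (α := ℝ)]; push_cast; constructor <;> intro h <;> linarith
  have h4 : (j : ℝ) + 1 + 1 = (k : ℝ) + 1 ↔ k = j + 1 := by
    rw [← Nat.cast_inj (R := ℝ)]; push_cast; constructor <;> intro h <;> linarith
  simp only [Meet, Before, h1, h2, h3, h4]
  grind

theorem meet_nat_iff {s : UnitIvl} (h : s.a ≤ 0) (k : ℕ) (r : Prop) :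
    s.Meet ⟨(k : ℝ) + 1, True, r⟩ ↔ s.a = 0 ∧ k = 0 ∧ s.r := by
  rcases Nat.eq_zero_or_pos k with rfl | hk
  · simp only [Meet, Before]; grind
  · have : (1 : ℝ) ≤ k := by exact_mod_cast hk
    simp only [Meet, Before]; grind

theorem not_meet_nat {s : UnitIvl} (h : s.a < 1) {k : ℕ} (hk : Odd k) (r : Prop) :
    ¬ s.Meet ⟨(k : ℝ) + 1, True, r⟩ := by
  have : (1 : ℝ) ≤ k := by exact_mod_cast hk.pos
  simp only [Meet, Before]; grind

theorem represents_normalForm {s t : UnitIvl} (h : Admissible s t) (l rp rq : Prop) :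
    Represents (normalForm i s t l rp rq) := by
  obtain ⟨h1, h2, h3, h4, h5⟩ := h
  intro u v hu hv
  cases u with
  | p k =>
    have hk := k.2
    cases v with
    | p j => have hj := j.2; simp only [normalForm, meet_nat, RPVert.Edge, RPVert.InX] at *; grind
    | q j => have hj := j.2; simp only [normalForm, meet_nat, RPVert.Edge, RPVert.InX] at *; grind
    | y' =>
      rw [meet_comm]
      have := not_meet_nat h2 hu ((k : ℕ) < i ∨ rp)
      simpa [normalForm, RPVert.Edge] using this
    | x | x' | x₁'' | x'' => exact absurd trivial hv
    | y₁'' | y₂'' =>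
      rw [meet_comm]
      simp only [normalForm, RPVert.Edge]
      rw [meet_nat_iff (by norm_num)]
      norm_num
  | q k =>
    have hk := k.2
    cases v with
    | p j => have hj := j.2; simp only [normalForm, meet_nat, RPVert.Edge, RPVert.InX] at *; grind
    | q j => have hj := j.2; simp only [normalForm, meet_nat, RPVert.Edge, RPVert.InX] at *; grind
    | y' =>
      rw [meet_comm]
      have := not_meet_nat h2 hu ((k : ℕ) = i ∧ rq)
      simpa [normalForm, RPVert.Edge] using this
    | x | x' | x₁'' | x'' => exact absurd trivial hv
    | y₁'' | y₂'' =>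
      rw [meet_comm]
      simp only [normalForm, RPVert.Edge]
      rw [meet_nat_iff (by norm_num)]
      norm_num
  | x | x' | x₁'' | x'' =>
    cases v with
    | p j | q j =>
      simp only [normalForm, RPVert.Edge]
      rw [meet_nat_iff (by first | exact h4.le | norm_num)]
      first | (norm_num; done) | grind
    | x | x' | x₁'' | x'' => exact absurd trivial hv
    | y' | y₁'' | y₂'' =>
      simp only [normalForm, RPVert.Edge, Meet, Before] at *
      grind
  | y' | y₁'' | y₂'' => exact absurd hu id

/-- If `p k` and `q k` have the same left-closed start, an interval meeting only `p k` must touch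
its right end. So `p k` is right-closed, `q k` is right-open, and `p (k+1)`, `q (k+1)` both start
there, left-closed. -/
theorem Represents.chain {d : RPVert i → UnitIvl} (h : Represents d)
    (hp : (d (.p 0)).a = 1 ∧ (d (.p 0)).l) (hq : (d (.q 0)).a = 1 ∧ (d (.q 0)).l) (k : ℕ)
    (hk : k < i + 1) :
    ((d (.p ⟨k, hk⟩)).a = k + 1 ∧ (d (.p ⟨k, hk⟩)).l ∧ (k < i → (d (.p ⟨k, hk⟩)).r)) ∧
    (d (.q ⟨k, hk⟩)).a = k + 1 ∧ (d (.q ⟨k, hk⟩)).l ∧ (k < i → ¬ (d (.q ⟨k, hk⟩)).r) := by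
  have step : ∀ k (hk : k < i),
      (d (.p ⟨k, by omega⟩)).a = k + 1 ∧ (d (.p ⟨k, by omega⟩)).l ∧
      (d (.q ⟨k, by omega⟩)).a = k + 1 ∧ (d (.q ⟨k, by omega⟩)).l →
      ((d (.p ⟨k, by omega⟩)).r ∧ ¬ (d (.q ⟨k, by omega⟩)).r) ∧
      (d (.p ⟨k + 1, by omega⟩)).a = k + 2 ∧ (d (.p ⟨k + 1, by omega⟩)).l ∧
      (d (.q ⟨k + 1, by omega⟩)).a = k + 2 ∧ (d (.q ⟨k + 1, by omega⟩)).l := by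
    rintro k hk ⟨h1, h2, h3, h4⟩
    have e1 := h.meet (u := .p ⟨k, by omega⟩) (v := .p ⟨k + 1, by omega⟩) (by simp [RPVert.Edge])
    have e2 := h.meet (u := .p ⟨k, by omega⟩) (v := .q ⟨k + 1, by omega⟩) (by simp [RPVert.Edge])
    have e3 := h.not_meet (u := .q ⟨k, by omega⟩) (v := .p ⟨k + 1, by omega⟩)
      (by simp [RPVert.InX, Nat.odd_add_one]) (by simp [RPVert.Edge]) (by simp [RPVert.Edge]; omega)
    have e4 := h.not_meet (u := .q ⟨k, by omega⟩) (v := .q ⟨k + 1, by omega⟩)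
      (by simp [RPVert.InX, Nat.odd_add_one]) (by simp [RPVert.Edge]) (by simp [RPVert.Edge])
    simp only [Meet, Before] at e1 e2 e3 e4
    clear h hp hq
    grind
  have main : (d (.p ⟨k, hk⟩)).a = k + 1 ∧ (d (.p ⟨k, hk⟩)).l ∧
      (d (.q ⟨k, hk⟩)).a = k + 1 ∧ (d (.q ⟨k, hk⟩)).l := by
    induction k with
    | zero => simpa using ⟨hp.1, hp.2, hq.1, hq.2⟩
    | succ k ih =>
      obtain ⟨h1, h2, h3, h4⟩ := (step k (by omega) (ih (by omega) step)).2
      push_cast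
      exact ⟨by linarith, h2, by linarith, h4⟩
  exact ⟨⟨main.1, main.2.1, fun hk' => (step k hk' main).1.1⟩,
    main.2.2.1, main.2.2.2, fun hk' => (step k hk' main).1.2⟩

theorem Represents.eq_normalForm {d : RPVert i → UnitIvl} (h : Represents d) (hi : 1 ≤ i)
    (hx : (d .x).a = 0) (hs : Squeezed (d .x) (d .y₁'') (d .x') (d (.p 0))) :
    Admissible (d .y') (d .x'') ∧
      d = normalForm i (d .y') (d .x'') (d .x₁'').l (d (.p (Fin.last i))).r
        (d (.q (Fin.last i))).r := by
  obtain ⟨h1, h2, h3, h4, h5, h6, h7, h8, h9⟩ := hs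
  obtain ⟨k, hk⟩ : ∃ k : Fin (i + 1), (k : ℕ) = 1 := ⟨⟨1, by omega⟩, rfl⟩
  have x_y2 := h.meet (u := .x) (v := .y₂'') (by simp [RPVert.Edge])
  have x_q := h.meet (u := .x) (v := .q 0) (by simp [RPVert.Edge])
  have y'_x' := h.meet (u := .y') (v := .x') (by simp [RPVert.Edge])
  have y1_x1 := h.meet (u := .y₁'') (v := .x₁'') (by simp [RPVert.Edge])
  have y1_x'' := h.meet (u := .y₁'') (v := .x'') (by simp [RPVert.Edge])
  have y2_x'' := h.meet (u := .y₂'') (v := .x'') (by simp [RPVert.Edge])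
  have p_p := h.meet (u := .p 0) (v := .p k) (by simp [RPVert.Edge, hk])
  have x'_y2 := h.not_meet (u := .x') (v := .y₂'') (by simp [RPVert.InX]) (by simp [RPVert.Edge])
    (by simp [RPVert.Edge])
  have x'_q := h.not_meet (u := .x') (v := .q 0) (by simp [RPVert.InX]) (by simp [RPVert.Edge])
    (by simp [RPVert.Edge])
  have x1_y' := h.not_meet (u := .x₁'') (v := .y') (by simp [RPVert.InX]) (by simp [RPVert.Edge])
    (by simp [RPVert.Edge])
  have x1_y2 := h.not_meet (u := .x₁'') (v := .y₂'') (by simp [RPVert.InX])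
    (by simp [RPVert.Edge]) (by simp [RPVert.Edge])
  have x''_y' := h.not_meet (u := .x'') (v := .y') (by simp [RPVert.InX]) (by simp [RPVert.Edge])
    (by simp [RPVert.Edge])
  have x''_p := h.not_meet (u := .x'') (v := .p 0) (by simp [RPVert.InX]) (by simp [RPVert.Edge])
    (by simp [RPVert.Edge])
  have x''_q := h.not_meet (u := .x'') (v := .q 0) (by simp [RPVert.InX]) (by simp [RPVert.Edge])
    (by simp [RPVert.Edge])
  have p_q := h.not_meet (u := .p k) (v := .q 0) (by simp [RPVert.InX, hk])
    (by simp [RPVert.Edge]) (by simp [RPVert.Edge])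
  have p_y' := h.not_meet (u := .p k) (v := .y') (by simp [RPVert.InX, hk])
    (by simp [RPVert.Edge]) (by simp [RPVert.Edge])
  simp only [Meet, Before] at *
  rw [hx] at h3 h5 h7
  norm_num at h3 h5
  have y'_pos : -1 < (d .y').a ∧ (d .y').a < 1 := by
    clear x_y2 x_q y1_x1 y1_x'' y2_x'' p_p x'_y2 x'_q x1_y' x1_y2 x''_y' x''_p x''_q p_q p_y'
    grind
  -- `y₂''` meets `x` but not its interior `x'`, so it touches one end of `x`. At the right end,
  -- `x''` would have to be `[0,1]` to meet `y₁''` and `y₂''`, and would then meet `y'`.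
  have y2_pos : (d .y₂'').a = -1 ∧ (d .y₂'').r := by
    clear x_q y1_x1 p_p x'_q x1_y' x1_y2 x''_p x''_q p_q p_y'
    grind
  -- `y₁''` and `y₂''` can differ only at `-1`, so this is where `x₁''` meets the former and misses
  -- the latter.
  have x1_pos : ((d .x₁'').a = -2 ∧ (d .x₁'').r) ∧ (d .y₁'').l ∧ ¬ (d .y₂'').l := by
    clear x_q y'_x' y1_x'' p_p x'_q x1_y' x''_y' x''_p x''_q p_q p_y' x'_y2 y2_x''
    grind
  have x''_pos : -2 < (d .x'').a ∧ (d .x'').a < 0 ∧ ((d .x'').a + 1 < (d .y').a ∨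
      (d .x'').a + 1 = (d .y').a ∧ ¬ ((d .x'').r ∧ (d .y').l)) := by
    clear x_q y1_x1 p_p x'_q x1_y' x1_y2 x''_q p_q p_y' x'_y2 x_y2 y1_x''
    grind
  -- On the left side `q 0` would contain `(-1,0]`, the interval of `y₂''`, and hence meet `x''`.
  have q_pos : (d (.q 0)).a = 1 ∧ (d (.q 0)).l := by
    clear x_y2 y1_x1 p_p x1_y' x1_y2 p_q p_y' x'_y2 y1_x'' x''_y' y'_x' x''_p
    grind
  have hc := fun k : Fin (i + 1) => h.chain ⟨h5, h6⟩ q_pos k k.2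
  refine ⟨⟨y'_pos.1, y'_pos.2, x''_pos.1, x''_pos.2.1, x''_pos.2.2⟩, ?_⟩
  funext v
  cases v with
  | p k =>
    obtain ⟨⟨c1, c2, c3⟩, -⟩ := hc k
    rcases (Nat.lt_succ_iff.1 k.2).lt_or_eq with hk' | hk'
    · ext <;> simp [normalForm, c1, c2, c3 hk', hk']
    · obtain rfl : k = Fin.last i := Fin.ext hk'
      ext <;> simp_all [normalForm]
  | q k =>
    obtain ⟨-, c1, c2, c3⟩ := hc k
    rcases (Nat.lt_succ_iff.1 k.2).lt_or_eq with hk' | hk'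
    · ext <;> simp [normalForm, c1, c2, c3 hk', hk'.ne]
    · obtain rfl : k = Fin.last i := Fin.ext hk'
      ext <;> simp_all [normalForm]
  | _ => ext <;> simp [normalForm, *]

/-! ### Trivial modifications and uniqueness -/

namespace Bigraph

variable {V : Type u} {B : Bigraph V}

theorem Change.symm {I J : V → Set ℝ} (h : B.Change I J) : B.Change J I := by
  cases h with
  | shift v t hv h =>
    exact .shift v (-t) (by rw [hv, Set.image_image]; simp only [add_neg_cancel_right, Set.image_id']) fun w hw => (h w hw).symm
  | retype v hl hr h => exact .retype v hl.symm hr.symm fun w hw => (h w hw).symm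
  | reflect c h => exact .reflect c fun v => by simp [h, Set.image_image]
  | translate t h =>
    exact .translate (-t) fun v => by
      rw [h, Set.image_image]; simp only [add_neg_cancel_right, Set.image_id']
  | relabel hX hY => exact .relabel hX.symm hY.symm

theorem TrivialModification.symm {I J : V → Set ℝ} (h : B.TrivialModification I J) :
    B.TrivialModification J I :=
  ⟨h.2.1, h.1, h.2.2.symm⟩

end Bigraph

open Relation (ReflTransGen)

/-- `d` and `d'` are connected by a sequence of trivial modifications. -/
def Modifies (d d' : RPVert i → UnitIvl) : Prop :=
  ReflTransGen (RP i).TrivialModification (fun v => (d v).toSet) (fun v => (d' v).toSet)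

theorem Modifies.trans {d d' d'' : RPVert i → UnitIvl} (h : Modifies d d') (h' : Modifies d' d'') :
    Modifies d d'' :=
  ReflTransGen.trans h h'

theorem Modifies.symm {d d' : RPVert i → UnitIvl} (h : Modifies d d') : Modifies d' d :=
  haveI : Std.Symm (RP i).TrivialModification := ⟨fun _ _ => Bigraph.TrivialModification.symm⟩
  ReflTransGen.stdSymm.symm _ _ h

theorem Represents.modifies {d d' : RPVert i → UnitIvl} (h : Represents d) (h' : Represents d')
    (hc : (RP i).Change (fun v => (d v).toSet) fun v => (d' v).toSet) : Modifies d d' :=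
  .single ⟨(isRep_iff_represents d).2 h, (isRep_iff_represents d').2 h', hc⟩

theorem Represents.modifies_retype {d d' : RPVert i → UnitIvl} (h : Represents d)
    (h' : Represents d') (v : RPVert i) (hv : (d' v).a = (d v).a)
    (hw : ∀ w, w ≠ v → d' w = d w) : Modifies d d' :=
  h.modifies h' <| .retype v (by simp only [sInf_toSet, hv]) (by simp only [sSup_toSet, hv])
    fun w hw' => by simp only [hw w hw']

theorem Represents.modifies_shift {d d' : RPVert i → UnitIvl} (h : Represents d)
    (h' : Represents d') (v : RPVert i) (t : ℝ) (hv : d' v = (d v).translate t)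
    (hw : ∀ w, w ≠ v → d' w = d w) : Modifies d d' :=
  h.modifies h' <| .shift v t (by simp only [hv, toSet_translate])
    fun w hw' => by simp only [hw w hw']

theorem Represents.modifies_translate {d : RPVert i → UnitIvl} (h : Represents d) (t : ℝ) :
    Modifies d fun v => (d v).translate t :=
  h.modifies (h.translate t) <| .translate t fun v => toSet_translate t (d v)

theorem Represents.modifies_reflect {d : RPVert i → UnitIvl} (h : Represents d) (c : ℝ) :
    Modifies d fun v => (d v).reflect c :=
  h.modifies (h.reflect c) <| .reflect c fun v => toSet_reflect c (d v)

/-- `swapLegs` is not injective: `p 1` and `q 1` both receive the interval of `x'`, and that of `q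
1` is dropped. By `hd` the dropped interval survives as that of `p 1`, so the sets of intervals
agree and this is a relabeling. -/
theorem Represents.modifies_swapLegs {d : RPVert i → UnitIvl} (h : Represents d) (hi : i = 1)
    (hd : d (.p (Fin.last i)) = d (.q (Fin.last i))) : Modifies d fun v => d (swapLegs v) := by
  refine h.modifies (h.comp_swapLegs hi) ?_
  subst hi
  have hX : ∀ v : RPVert 1, v ∈ (RP 1).X ↔ v.InX := fun v => Iff.rfl
  have hY : ∀ v : RPVert 1, v ∈ (RP 1).Y ↔ ¬ v.InX := fun v => Iff.rfl
  have hl : Fin.last 1 = 1 := rfl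
  rw [hl] at hd
  have key : ∀ v : RPVert 1, ((swapLegs v).InX ↔ v.InX) ∧
      ∃ w : RPVert 1, (w.InX ↔ v.InX) ∧ d (swapLegs w) = d v := by
    intro v
    cases v with
    | p k =>
      fin_cases k
      · exact ⟨by simp [swapLegs, RPVert.InX], .y', by simp [RPVert.InX], rfl⟩
      · exact ⟨by simp [swapLegs, RPVert.InX], .x', by simp [RPVert.InX], rfl⟩
    | q k =>
      fin_cases k
      · exact ⟨by simp [swapLegs, RPVert.InX], .q 0, by simp [RPVert.InX], rfl⟩
      · exact ⟨by simp [swapLegs, RPVert.InX], .x', by simp [RPVert.InX], hd⟩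
    | y' => exact ⟨by simp [swapLegs, RPVert.InX], .p 0, by simp [RPVert.InX], rfl⟩
    | x' => exact ⟨by simp [swapLegs, RPVert.InX], .p 1, by simp [RPVert.InX], rfl⟩
    | x => exact ⟨Iff.rfl, .x, Iff.rfl, rfl⟩
    | y₁'' => exact ⟨Iff.rfl, .y₁'', Iff.rfl, rfl⟩
    | x₁'' => exact ⟨Iff.rfl, .x₁'', Iff.rfl, rfl⟩
    | y₂'' => exact ⟨Iff.rfl, .y₂'', Iff.rfl, rfl⟩
    | x'' => exact ⟨Iff.rfl, .x'', Iff.rfl, rfl⟩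
  refine .relabel ?_ ?_
  · ext S
    simp only [Set.mem_image, hX]
    constructor
    · rintro ⟨v, hv, rfl⟩
      exact ⟨swapLegs v, (key v).1.2 hv, rfl⟩
    · rintro ⟨v, hv, rfl⟩
      obtain ⟨w, hw, e⟩ := (key v).2
      exact ⟨w, hw.2 hv, by rw [e]⟩
  · ext S
    simp only [Set.mem_image, hY]
    constructor
    · rintro ⟨v, hv, rfl⟩
      exact ⟨swapLegs v, mt (key v).1.1 hv, rfl⟩
    · rintro ⟨v, hv, rfl⟩
      obtain ⟨w, hw, e⟩ := (key v).2
      exact ⟨w, mt hw.1 hv, by rw [e]⟩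

theorem modifies_normalForm_types {s t : UnitIvl} (h : Admissible s t) (l rp rq l' rp' rq' : Prop) :
    Modifies (normalForm i s t l rp rq) (normalForm i s t l' rp' rq') := by
  have r := represents_normalForm (i := i) h
  refine ((r l rp rq).modifies_retype (r l' rp rq) .x₁'' rfl ?_).trans
    (((r l' rp rq).modifies_retype (r l' rp' rq) (.p (Fin.last i)) rfl ?_).trans
    ((r l' rp' rq).modifies_retype (r l' rp' rq') (.q (Fin.last i)) rfl ?_))
  · intro w hw
    cases w <;> first | rfl | exact absurd rfl hw
  · intro w hw
    cases w with
    | p k =>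
      have : (k : ℕ) < i := lt_of_le_of_ne (Nat.lt_succ_iff.1 k.2)
        fun e => hw (congrArg _ (Fin.ext e))
      simp [normalForm, this]
    | _ => rfl
  · intro w hw
    cases w with
    | q k =>
      have : (k : ℕ) ≠ i := fun e => hw (congrArg _ (Fin.ext e))
      simp [normalForm, this]
    | _ => rfl

/-- Retyping before shifting keeps the intermediate family a representation: by `hr` the end of
`x''` facing `y'` becomes open, so no new intersection arises. -/
theorem modifies_normalForm_x'' {s t t' : UnitIvl} (h : Admissible s t) (h' : Admissible s t')
    (hr : ¬ t'.r) (l rp rq : Prop) :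
    Modifies (normalForm i s t l rp rq) (normalForm i s t' l rp rq) := by
  have h'' : Admissible s ⟨t.a, t'.l, t'.r⟩ := by
    obtain ⟨h1, h2, h3, h4, h5⟩ := h
    exact ⟨h1, h2, h3, h4, by simp only [Before] at *; grind⟩
  refine ((represents_normalForm h l rp rq).modifies_retype (represents_normalForm h'' l rp rq)
    .x'' rfl ?_).trans ((represents_normalForm h'' l rp rq).modifies_shift
    (represents_normalForm h' l rp rq) .x'' (t'.a - t.a) ?_ ?_)
  · intro w hw
    cases w <;> first | rfl | exact absurd rfl hw
  · ext <;> simp [normalForm, UnitIvl.translate]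
  · intro w hw
    cases w <;> first | rfl | exact absurd rfl hw

theorem modifies_normalForm_y' {s s' t : UnitIvl} (h : Admissible s t) (h' : Admissible s' t)
    (hl : ¬ s'.l) (l rp rq : Prop) :
    Modifies (normalForm i s t l rp rq) (normalForm i s' t l rp rq) := by
  have h'' : Admissible ⟨s.a, s'.l, s'.r⟩ t := by
    obtain ⟨h1, h2, h3, h4, h5⟩ := h
    exact ⟨h1, h2, h3, h4, by simp only [Before] at *; grind⟩
  refine ((represents_normalForm h l rp rq).modifies_retype (represents_normalForm h'' l rp rq)
    .y' rfl ?_).trans ((represents_normalForm h'' l rp rq).modifies_shift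
    (represents_normalForm h' l rp rq) .y' (s'.a - s.a) ?_ ?_)
  · intro w hw
    cases w <;> first | rfl | exact absurd rfl hw
  · ext <;> simp [normalForm, UnitIvl.translate]
  · intro w hw
    cases w <;> first | rfl | exact absurd rfl hw

theorem admissible_standard : Admissible ⟨0, False, False⟩ ⟨-1, False, False⟩ := by
  constructor <;> norm_num [Before]

theorem modifies_standard {s t : UnitIvl} (h : Admissible s t) (l rp rq : Prop) :
    Modifies (normalForm i s t l rp rq)
      (normalForm i ⟨0, False, False⟩ ⟨-1, False, False⟩ l rp rq) := by
  have h0 := h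
  obtain ⟨h1, h2, h3, h4, h5⟩ := h
  -- The order of the two moves matters. If `y'` starts at `0` or later, `(-1,0)` is free for `x''`;
  -- otherwise `x''` ends before `0`, and `y'` can first move to `(0,1)`.
  rcases le_or_gt 0 s.a with hs | hs
  · have h' : Admissible s ⟨-1, False, False⟩ := by
      constructor <;> simp only [Before] at * <;> grind
    exact (modifies_normalForm_x'' h0 h' id l rp rq).trans
      (modifies_normalForm_y' h' admissible_standard id l rp rq)
  · have h' : Admissible ⟨0, False, False⟩ t := by
      constructor <;> simp only [Before] at * <;> grind
    exact (modifies_normalForm_y' h0 h' id l rp rq).trans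
      (modifies_normalForm_x'' h' admissible_standard id l rp rq)

theorem Represents.modifies_of_squeezed {d : RPVert i → UnitIvl} (h : Represents d)
    (hi : 1 ≤ i) (hs : Squeezed (d .x) (d .y₁'') (d .x') (d (.p 0)) ∨
      Squeezed (d .x) (d (.p 0)) (d .x') (d .y₁'')) (l rp rq : Prop) :
    Modifies d (normalForm i ⟨0, False, False⟩ ⟨-1, False, False⟩ l rp rq) := by
  have main : ∀ d : RPVert i → UnitIvl, Represents d →
      Squeezed (d .x) (d .y₁'') (d .x') (d (.p 0)) →
      Modifies d (normalForm i ⟨0, False, False⟩ ⟨-1, False, False⟩ l rp rq) := by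
    intro d h hs
    refine (h.modifies_translate (-(d .x).a)).trans ?_
    obtain ⟨ha, he⟩ := (h.translate (-(d .x).a)).eq_normalForm hi (by simp [UnitIvl.translate])
      (hs.translate _)
    rw [he]
    exact (modifies_standard ha _ _ _).trans (modifies_normalForm_types admissible_standard ..)
  rcases hs with hs | hs
  · exact main d h hs
  · exact (h.modifies_reflect 0).trans (main _ (h.reflect 0) (hs.reflect 0))

theorem Represents.modifies_standard {d : RPVert i → UnitIvl} (h : Represents d) (hi : 1 ≤ i)
    (l rp rq : Prop) :
    Modifies d (normalForm i ⟨0, False, False⟩ ⟨-1, False, False⟩ l rp rq) := by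
  rcases h.exists_squeezed hi with hs | ⟨rfl, hd, hs⟩
  · exact h.modifies_of_squeezed hi hs l rp rq
  · exact (h.modifies_swapLegs rfl hd).trans
      ((h.comp_swapLegs rfl).modifies_of_squeezed hi hs l rp rq)

theorem model_eq (i : ℕ) (l : Prop) :
    model i (toSet ⟨-2, l, True⟩) = fun v =>
      (normalForm i ⟨0, False, False⟩ ⟨-1, False, False⟩ l True False v).toSet := by
  funext v
  cases v <;> simp only [model, normalForm, or_true, and_false, toSet_closed, toSet_open,
    toSet_closedOpen, toSet_openClosed] <;> norm_num [add_assoc]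

theorem isUniqueRep_model (hi : 1 ≤ i) (l : Prop) :
    (RP i).IsUniqueRep (model i (toSet ⟨-2, l, True⟩)) := by
  rw [model_eq]
  refine ⟨(isRep_iff_represents _).2 (represents_normalForm admissible_standard _ _ _), ?_⟩
  intro J hJ
  obtain ⟨d, hd, rfl⟩ := exists_represents hJ
  exact (hd.modifies_standard hi l True False).symm

/-! ### `R_i` is forbidden -/

/-- The intervals of `v'` and `v''` have equal end points and agree at one of them. -/
theorem Represents.last_comparable {d : RPVert i → UnitIvl} (h : Represents d) (hi : 1 ≤ i) :
    (d (.p (Fin.last i))).a = (d (.q (Fin.last i))).a ∧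
      (((d (.p (Fin.last i))).l ↔ (d (.q (Fin.last i))).l) ∨
        ((d (.p (Fin.last i))).r ↔ (d (.q (Fin.last i))).r)) := by
  have main : ∀ d : RPVert i → UnitIvl, Represents d →
      Squeezed (d .x) (d .y₁'') (d .x') (d (.p 0)) →
      (d (.p (Fin.last i))).a = (d (.q (Fin.last i))).a ∧
      ((d (.p (Fin.last i))).l ↔ (d (.q (Fin.last i))).l) := by
    intro d h hs
    obtain ⟨-, he⟩ := (h.translate (-(d .x).a)).eq_normalForm hi (by simp [UnitIvl.translate])
      (hs.translate _)
    have hp := congrFun he (.p (Fin.last i))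
    have hq := congrFun he (.q (Fin.last i))
    simp only [UnitIvl.translate, normalForm, UnitIvl.mk.injEq] at hp hq
    exact ⟨by linarith [hp.1, hq.1], by rw [hp.2.1, hq.2.1]⟩
  -- In the normal form both intervals are left-closed. A reflection turns this into agreement on
  -- the right, and in the exceptional case the intervals coincide.
  rcases h.exists_squeezed hi with (hs | hs) | ⟨-, hd, -⟩
  · exact ⟨(main d h hs).1, Or.inl (main d h hs).2⟩
  · have := main _ (h.reflect 0) (hs.reflect 0)
    simp only [UnitIvl.reflect] at this
    exact ⟨by linarith [this.1], Or.inr this.2⟩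
  · rw [hd]
    exact ⟨rfl, Or.inl Iff.rfl⟩

/-- Equal end points and agreement at one of them make the two intervals nested. -/
theorem Represents.not_both_private {d : RPVert i → UnitIvl} (h : Represents d) (hi : 1 ≤ i)
    {s t : UnitIvl} (hs : (d (.p (Fin.last i))).Meet s) (ht : (d (.q (Fin.last i))).Meet t)
    (hs' : ¬ (d (.q (Fin.last i))).Meet s) (ht' : ¬ (d (.p (Fin.last i))).Meet t) : False := by
  obtain ⟨h1, h2⟩ := h.last_comparable hi
  generalize d (.p (Fin.last i)) = p at *
  generalize d (.q (Fin.last i)) = q at *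
  simp only [Meet, Before] at *
  clear h hi
  grind

theorem Bigraph.IsRep.adj_iff {V : Type u} {B : Bigraph V} {M : Set (Set ℝ)} {I : V → Set ℝ}
    (h : B.IsRep M I) {u v : V} (ho : B.Opposite u v) :
    B.graph.Adj u v ↔ (I u ∩ I v).Nonempty := by
  have hne : u ≠ v := by
    rintro rfl
    rcases ho with ho | ho
    · exact B.bipartite.disjoint.le_bot ho
    · exact B.bipartite.disjoint.le_bot ho.symm
  rw [h.2 u v hne, and_iff_left ho]

theorem Bigraph.mem_X_iff_of_adj {V : Type u} (B : Bigraph V) {u v : V} (h : B.graph.Adj u v) :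
    u ∈ B.X ↔ v ∉ B.X := by
  have hd := Set.disjoint_left.1 B.bipartite.disjoint
  rcases B.bipartite.mem_of_adj h with ⟨h1, h2⟩ | ⟨h1, h2⟩
  · exact ⟨fun _ h3 => hd h3 h2, fun _ => h1⟩
  · exact ⟨fun h3 => absurd h1 (hd h3), fun h3 => absurd h2 h3⟩

theorem Bigraph.opposite_of_not_iff {V : Type u} (B : Bigraph V) {u v : V}
    (h : u ∈ B.X ↔ v ∉ B.X) : B.Opposite u v := by
  have hc : ∀ w, w ∉ B.X → w ∈ B.Y := fun w hw =>
    (B.cover.symm ▸ Set.mem_univ w : w ∈ B.X ∪ B.Y).resolve_left hw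
  by_cases hu : u ∈ B.X
  · exact Or.inl ⟨hu, hc v (h.1 hu)⟩
  · exact Or.inr ⟨hc u hu, by tauto⟩

/-- A coloring of `R_i` by two colors is its bipartition. -/
theorem RVert.color_iff (c : RVert i → Prop)
    (hc : ∀ {a b : RVert i}, REdge i a b → (c a ↔ ¬ c b)) (v : RVert i) :
    c v ↔ (v.InX ↔ c (.core .x)) := by
  have core {a b : RPVert i} (e : a.Edge b) : c (.core a) ↔ ¬ c (.core b) :=
    hc (.core ((rpEdge_iff a b).2 e))
  have hp : ∀ k (hk : k < i + 1), c (.core (.p ⟨k, hk⟩)) ↔ (Odd k ↔ c (.core .x)) := by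
    intro k hk
    induction k with
    | zero =>
      have := core (a := .x) (b := .p ⟨0, hk⟩) rfl
      simp; tauto
    | succ k ih =>
      have := core (a := .p ⟨k, by omega⟩) (b := .p ⟨k + 1, hk⟩) rfl
      have := ih (by omega)
      rw [Nat.odd_add_one]
      tauto
  have hq : ∀ k (hk : k < i + 1), c (.core (.q ⟨k, hk⟩)) ↔ (Odd k ↔ c (.core .x)) := by
    intro k hk
    cases k with
    | zero =>
      have := core (a := .x) (b := .q ⟨0, hk⟩) rfl
      simp; tauto
    | succ k =>
      have := core (a := .p ⟨k, by omega⟩) (b := .q ⟨k + 1, hk⟩) rfl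
      have := hp k (by omega)
      rw [Nat.odd_add_one]
      tauto
  have h1 := core (a := .x) (b := .y') trivial
  have h2 := core (a := .y') (b := .x') trivial
  have h3 := core (a := .x) (b := .y₁'') trivial
  have h4 := core (a := .y₁'') (b := .x₁'') trivial
  have h5 := core (a := .x) (b := .y₂'') trivial
  have h6 := core (a := .y₁'') (b := .x'') trivial
  cases v with
  | core v =>
    cases v with
    | p k => exact hp k k.2
    | q k => exact hq k k.2
    | _ => simp only [RVert.InX, RPVert.InX]; tauto
  | w' =>
    have := hc REdge.v'_w'
    have := hp i (by omega)
    simp only [RVert.InX, Fin.last] at *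
    tauto
  | w'' =>
    have := hc REdge.v''_w''
    have := hq i (by omega)
    simp only [RVert.InX, Fin.last] at *
    tauto

theorem isForbiddenInducedSubgraph_R (hi : 1 ≤ i) : IsForbiddenInducedSubgraph.{u} (R i) := by
  rintro V B ⟨I, hI⟩ ⟨f⟩
  have hadj : ∀ a b : RVert i, B.graph.Adj (f a) (f b) ↔ a ≠ b ∧ (REdge i a b ∨ REdge i b a) := by
    intro a b
    rw [f.map_adj_iff]
    exact SimpleGraph.fromRel_adj _ _ _
  -- An embedding of graphs need not respect the partite sets. As `R i` is connected, it preserves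
  -- or exchanges them, so opposite vertices stay opposite and non-adjacency still means disjoint
  -- intervals.
  have hcol := RVert.color_iff (fun v => f v ∈ B.X) fun {a b} e => B.mem_X_iff_of_adj <|
    (hadj a b).2 ⟨by rintro rfl; have := e.inX_iff; tauto, Or.inl e⟩
  choose D hD using fun v => exists_toSet_eq (hI.1 v)
  have hmeet : ∀ a b : RVert i, (a.InX ↔ ¬ b.InX) →
      ((REdge i a b ∨ REdge i b a) ↔ (D (f a)).Meet (D (f b))) := by
    intro a b hab
    have ha := hcol a
    have hb := hcol b
    rw [← inter_nonempty_iff, hD, hD, ← hI.adj_iff (B.opposite_of_not_iff (by tauto)), hadj,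
      and_iff_right]
    rintro rfl
    tauto
  have hrep : Represents fun v : RPVert i => D (f (.core v)) := by
    intro u v hu hv
    rw [← hmeet (.core u) (.core v) (by simp only [RVert.InX]; tauto), ← rpEdge_iff, ← rpEdge_iff]
    constructor
    · exact Or.imp .core .core
    · exact Or.imp (fun e => by cases e; assumption) (fun e => by cases e; assumption)
  refine hrep.not_both_private hi (s := D (f .w')) (t := D (f .w'')) ?_ ?_ ?_ ?_
  · exact (hmeet _ _ (by simp [RVert.InX, RPVert.InX])).1 (Or.inl .v'_w')
  · exact (hmeet _ _ (by simp [RVert.InX, RPVert.InX])).1 (Or.inl .v''_w'')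
  · rw [← hmeet _ _ (by simp [RVert.InX, RPVert.InX])]
    rintro (e | e) <;> cases e
  · rw [← hmeet _ _ (by simp [RVert.InX, RPVert.InX])]
    rintro (e | e) <;> cases e

end MixedUnitBigraph

theorem lemma10 (i : ℕ) (hi : 1 ≤ i) :
    (MixedUnitBigraph.RP i).IsUniqueRep (MixedUnitBigraph.model i (Set.Icc (-2) (-1))) ∧
    (MixedUnitBigraph.RP i).IsUniqueRep (MixedUnitBigraph.model i (Set.Ioc (-2) (-1))) ∧
    MixedUnitBigraph.IsForbiddenInducedSubgraph.{u} (MixedUnitBigraph.R i) := by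
  refine ⟨?_, ?_, MixedUnitBigraph.isForbiddenInducedSubgraph_R hi⟩
  · have h := MixedUnitBigraph.isUniqueRep_model hi True
    rw [MixedUnitBigraph.UnitIvl.toSet_closed] at h
    norm_num at h
    exact h
  · have h := MixedUnitBigraph.isUniqueRep_model hi False
    rw [MixedUnitBigraph.UnitIvl.toSet_openClosed] at h
    norm_num at h
    exact h
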